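/- Let $H$ be the real Hilbert space of $2\pi$-periodic, real, divergence-free, mean-zero, square-integrable vector fields $u(x)=\sum_{k\in\mathbb Z^2\setminus\{0\}}\hat u(k)e^{ik\cdot x}$ on $\mathbb R^2$, with the scalar product $(u,v)=\int_{[0,2\pi]^2}u\cdot v\,dx$ and $|u|^2=(u,u)$. Let $A$ be the Stokes operator, with powers $\widehat{A^su}(k)=|k|^{2s}\hat u(k)$, let $E_\mu$ be the orthogonal projector of $H$ onto the modes with $|k|^2=\mu$ (so $E_\mu=0$ if $\mu$ is not an eigenvalue of $A$), and let $$\hat B(u,v)(k)=i\sum_{j}\Big[(\hat u(k-j)\cdot j)\hat v(j)-\frac{(\hat u(k-j)\cdot j)(\hat v(j)\cdot k)}{k\cdot k}k\Big],\qquad k\neq0.$$ Let $g\in H$, $g\ne0$, $Ag=\lambda g$ with $\lambda=2$. A solution is a differentiable $u:\mathbb R\to H$ with values in $D(A)$ such that $\frac{du}{dt}+Au+B(u,u)=g$ for all $t\in\mathbb R$. The global attractor $\mathcal A$ is the set of values $u(0)$ of the solutions $u$ with $\sup_{t\in\mathbb R}|u(t)|<\infty$. A ghost solution is a nonstationary solution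 $u$ with $u(t)\in\mathcal A$ for all $t$, whose energy $e=|u(t)|^2$ and enstrophy $E=|A^{1/2}u(t)|^2$ satisfy $\dot e\equiv\dot E\equiv0$. It is chained if there are constants $\gamma,\beta,\alpha\in\mathbb R$ with $A^2u(t)=\gamma g+\beta u(t)+\alpha Au(t)$ for all $t\in\mathbb R$. Then: (i) For every chained ghost solution $u$ and all constants $\gamma,\beta,\alpha$ as above, $\alpha^2+4\beta>0$, the numbers $\mu_\pm=\frac12\big(\alpha\pm\sqrt{\alpha^2+4\beta}\big)$ are $\mu_-=1$ and $\mu_+=5$, and $u(t)=E_{5}u(t)+E_{1}u(t)+\frac{E}{|g|^2}g$ for all $t$. Moreover, if real numbers $\mu_-<2<\mu_+$ and $\eta$ satisfy $$u(t)=E_{\mu_+}u(t)+E_{\mu_-}u(t)+\eta g\quad\text{for all }t\in\mathbb R,\tag{$*$}$$ then $\mu_-=1$ and $\mu_+=5$. (ii) Let $u$ be any solution with $\sup_{t\in\mathbb R}|u(t)|<\infty$ that has a decomposition $(*)$ with real numbers $\mu_-<2<\mu_+$ and $\eta$, and put $u_\pm=E_{\mu_\pm}u$. If $\mu_+\neq5$,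 then for all $t$: $(B(u_-,g),u_+)=0$ and $(B(g,u_-),u_+)=0$, the energy equation of $u_+$ has no forcing, that is, $\frac12\frac{d}{dt}|u_+|^2+\mu_+|u_+|^2=0$; consequently $u_+\equiv0$, and $u\equiv\eta g$ is stationary. -/

import Mathlib

open Set

namespace NavierStokes2D

noncomputable section

/-- Wave vectors `k ∈ ℤ²`. -/
abbrev Wave := ℤ × ℤ

/-- Vectors in `ℂ²`. -/
abbrev CVec := EuclideanSpace ℂ (Fin 2)

/-- Families of Fourier coefficients `(a(k))`, `a(k) ∈ ℂ²`. -/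
abbrev Coeff := Wave → CVec

/-- `k · k = |k|²`. -/
def waveSq (k : Wave) : ℝ := (k.1 : ℝ) ^ 2 + (k.2 : ℝ) ^ 2

/-- The wave vector `k` as an element of `ℂ²`. -/
def waveVec (k : Wave) : CVec := !₂[(k.1 : ℂ), (k.2 : ℂ)]

/-- The bilinear (not sesquilinear) dot product of `ℂ²`. -/
def cdot (a b : CVec) : ℂ := a 0 * b 0 + a 1 * b 1

/-- The phase space `H` of `2π`-periodic, real, divergence free, mean zero, square integrable vector
fields `u(x) = ∑ û(k) e^{i k·x}` on the plane, each given by its Fourier coefficients `û`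
(indexed by `ℤ²`, with `û(0) = 0`). Its topology is that of `ℓ²`; by Parseval, the
`L²([0,2π]²)` norm is `2π` times the `ℓ²` norm. -/
def H : Submodule ℝ (lp (fun _ : Wave => CVec) 2) where
  carrier := {a | a 0 = 0 ∧ (∀ k, cdot (waveVec k) (a k) = 0) ∧
    ∀ k i, star (a k i) = a (-k) i}
  zero_mem' := by simp [cdot]
  add_mem' := by
    rintro a b ⟨ha0, ha1, ha2⟩ ⟨hb0, hb1, hb2⟩
    refine ⟨by simp [ha0, hb0], fun k => ?_, fun k i => ?_⟩
    · have h1 := ha1 k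
      have h2 := hb1 k
      simp only [cdot, lp.coeFn_add, Pi.add_apply, PiLp.add_apply] at h1 h2 ⊢
      linear_combination h1 + h2
    · have h1 := ha2 k i
      have h2 := hb2 k i
      simp only [lp.coeFn_add, Pi.add_apply, PiLp.add_apply, star_add, h1, h2]
  smul_mem' := by
    rintro c a ⟨ha0, ha1, ha2⟩
    refine ⟨by simp [ha0], fun k => ?_, fun k i => ?_⟩
    · have h1 := ha1 k
      simp only [cdot, lp.coeFn_smul, Pi.smul_apply, PiLp.smul_apply, Complex.real_smul] at h1 ⊢
      linear_combination (c : ℂ) * h1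
    · have h1 := ha2 k i
      simp only [lp.coeFn_smul, Pi.smul_apply, PiLp.smul_apply, star_smul, h1, star_trivial]

/-- The Fourier coefficients of an element of `H`. -/
def coeff (u : H) : Coeff := fun k => (u : lp (fun _ : Wave => CVec) 2) k

/-- The scalar product `(a, b) = ∫_{[0,2π]²} a(x) · b(x) dx` of two real vector fields, through
their Fourier coefficients: `(2π)² ∑ₖ a(k) · b(k)^*`. -/
def scal (a b : Coeff) : ℝ :=
  (2 * Real.pi) ^ 2 * ∑' k : Wave, ∑ i : Fin 2, (a k i * star (b k i)).re

/-- The squared norm `|a|² = (a, a)`. -/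
def normSq (a : Coeff) : ℝ := scal a a

/-- The powers `A^s` of the Stokes operator, acting as the Fourier multiplier `(k · k)^s`. -/
def stokesPow (s : ℝ) (a : Coeff) : Coeff := fun k => (waveSq k ^ s) • a k

/-- The domain `D(A^s)` in `H`. -/
def DomA (s : ℝ) : Set H :=
  {u | Summable fun k : Wave => waveSq k ^ (2 * s) * ‖coeff u k‖ ^ 2}

/-- The Stokes operator `A`. -/
def stokes (a : Coeff) : Coeff := stokesPow 1 a

/-- The bilinear term `B(a, b)`, the divergence free part of `(a · ∇) b`, through its Fourier
coefficients `i ∑ⱼ [(a(k-j) · j) b(j) - ((a(k-j) · j) (b(j) · k) / (k · k)) k]`, `k ≠ 0`. The series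
converges absolutely when `a` and `b` belong to `D(A)`. -/
def bilin (a b : Coeff) : Coeff := fun k =>
  if k = 0 then 0 else
    Complex.I • ∑' j : Wave,
      (cdot (a (k - j)) (waveVec j) • b j -
        (cdot (a (k - j)) (waveVec j) * cdot (b j) (waveVec k) / (waveSq k : ℂ)) • waveVec k)

/-- The projector `E_μ` of `H` onto the eigenspace of `A` for the eigenvalue `μ`: it keeps the
Fourier modes with `k · k = μ` (it is zero if `μ` is not an eigenvalue). -/
def eigProj (μ : ℝ) (u : H) : H := by
  classical
  refine ⟨⟨fun k => if waveSq k = μ then coeff u k else 0, ?_⟩, ?_, ?_, ?_⟩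
  · refine (lp.memℓp (u : lp (fun _ : Wave => CVec) 2)).mono' (fun k => ?_)
    split_ifs
    · exact le_rfl
    · simp
  · change (if waveSq 0 = μ then coeff u 0 else 0) = 0
    split_ifs
    · exact u.2.1
    · rfl
  · intro k
    change cdot (waveVec k) (if waveSq k = μ then coeff u k else 0) = 0
    split_ifs
    · exact u.2.2.1 k
    · simp [cdot]
  · intro k i
    change star ((if waveSq k = μ then coeff u k else 0) i) =
      (if waveSq (-k) = μ then coeff u (-k) else 0) i
    have hk : waveSq (-k) = waveSq k := by simp [waveSq]
    rw [hk]
    split_ifs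
    · exact u.2.2.2 k i
    · simp

/-- `u : ℝ → H` is a solution, for all times, of the (dimensionless) functional form
`du/dt + A u + B(u, u) = g` of the Navier-Stokes equations: `u(t) ∈ D(A)`, `u` is differentiable
with values in `H`, and the equation holds at every time. -/
structure IsSolution (g : H) (u : ℝ → H) : Prop where
  mem_dom : ∀ t, u t ∈ DomA 1
  eqn : ∀ t, ∃ u' : H, HasDerivAt u u' t ∧
    coeff u' + stokes (coeff (u t)) + bilin (coeff (u t)) (coeff (u t)) = coeff g

/-- `sup_{t ∈ ℝ} |u(t)| < ∞`. -/
def IsBoundedSol (u : ℝ → H) : Prop :=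
  BddAbove (range fun t => Real.sqrt (normSq (coeff (u t))))

/-- The global attractor: the values at time `0` of the solutions that are defined and bounded
on all of `ℝ`. -/
def attractor (g : H) : Set H :=
  {u₀ | ∃ u : ℝ → H, IsSolution g u ∧ u 0 = u₀ ∧ IsBoundedSol u}

/-- `u` does not depend on time. -/
def IsSteady (u : ℝ → H) : Prop := ∀ s t, u s = u t

/-- The energy `e = |u|²`. -/
def energy (u : H) : ℝ := normSq (coeff u)

/-- The enstrophy `E = |A^{1/2} u|²`. -/
def enstrophy (u : H) : ℝ := normSq (stokesPow (1 / 2) (coeff u))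

/-- Ghost solutions: nonstationary solutions in the global attractor whose energy and enstrophy are
constant in time. -/
structure IsGhost (g : H) (u : ℝ → H) : Prop where
  sol : IsSolution g u
  mem_attractor : ∀ t, u t ∈ attractor g
  nonstationary : ¬ IsSteady u
  energy_const : ∀ t, HasDerivAt (fun s => energy (u s)) 0 t
  enstrophy_const : ∀ t, HasDerivAt (fun s => enstrophy (u s)) 0 t

/-- The chained relation `A² u(t) = γ g + β u(t) + α A u(t)` for all `t`, with coefficients that do
not depend on time. -/
def ChainRel (g : H) (u : ℝ → H) (γ β α : ℝ) : Prop :=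
  ∀ t, u t ∈ DomA 2 ∧
    stokesPow 2 (coeff (u t)) = γ • coeff g + β • coeff (u t) + α • stokes (coeff (u t))

/-- Chained ghost solutions. -/
def IsChainedGhost (g : H) (u : ℝ → H) : Prop :=
  IsGhost g u ∧ ∃ γ β α : ℝ, ChainRel g u γ β α

/-- The larger root `μ₊` of `μ² = α μ + β` (when `α² + 4 β > 0`). -/
def muPlus (α β : ℝ) : ℝ := (α + Real.sqrt (α ^ 2 + 4 * β)) / 2

/-- The smaller root `μ₋` of `μ² = α μ + β` (when `α² + 4 β > 0`). -/
def muMinus (α β : ℝ) : ℝ := (α - Real.sqrt (α ^ 2 + 4 * β)) / 2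

/-- The decomposition `u(t) = E_{μ₊} u(t) + E_{μ₋} u(t) + η g` for all `t`. -/
def Decomp (g : H) (u : ℝ → H) (μp μm η : ℝ) : Prop :=
  ∀ t, u t = eigProj μp (u t) + eigProj μm (u t) + η • g

end

end NavierStokes2D

open NavierStokes2D

namespace NavierStokes2D

noncomputable section

/-! Only finitely many modes occur, since the decomposition or the chained relation bounds `|k|²`,
so everything reduces to finite sums over triads `l + j + m = 0`. In terms of stream function
coefficients, the transfer by `B` into a spectral weight `q`, symmetrized over a triad, is a
multiple of `(|l|² - |j|²) q m + (|j|² - |m|²) q l + (|m|² - |l|²) q j` (`sum_transfer_eq_zero`). It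
vanishes for `q = 1` and `q = |k|²`, and for every radial `q` if two of the lengths agree.

The value 5 is lattice arithmetic: below 2 the only eigenvalue is 1, and a vector of squared length
1 plus one of squared length 2 has squared length 1 or 5. If `μ₊ ≠ 5`, no triad has three distinct
lengths, so `|E_μ u|²` with `μ ≠ 2` receives neither transfer nor forcing. It obeys `f' = -2 μ f`,
and boundedness as `t → -∞` forces it to vanish.

For a ghost, constant energy and enstrophy give `E = (g, u)` and `∑ (|k|² - 2) |k|² |û(k)|² = 0`.
Hence modes lie on both sides of `|k|² = 2`, or all on it; the latter forces `u = g / 2`, which is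
stationary (`IsGhost.not_one_sided`). Off that circle the chained relation is a quadratic equation
for `|k|²`, whose roots must therefore straddle 2. -/

theorem waveSq_neg (k : Wave) : waveSq (-k) = waveSq k := by simp [waveSq]

/-! ### Triads and the transfer by the bilinear term -/

/-- A sum over triples vanishes when its summand has zero symmetrization. -/
theorem sum_triple_eq_zero {ι : Type*} (S : Finset ι) (D : ι → ι → ι → ℂ)
    (h : ∀ l j m, D l j m + D j l m + D j m l + D m j l + D m l j + D l m j = 0) :
    ∑ m ∈ S, ∑ j ∈ S, ∑ l ∈ S, D l j m = 0 := by
  -- The two adjacent transpositions generate all permutations of the indices, so the six permuted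
  -- sums coincide.
  have hA : ∀ F : ι → ι → ι → ℂ, ∑ m ∈ S, ∑ j ∈ S, ∑ l ∈ S, F j l m =
      ∑ m ∈ S, ∑ j ∈ S, ∑ l ∈ S, F l j m := fun F =>
    Finset.sum_congr rfl fun m _ => Finset.sum_comm
  have hB : ∀ F : ι → ι → ι → ℂ, ∑ m ∈ S, ∑ j ∈ S, ∑ l ∈ S, F l m j =
      ∑ m ∈ S, ∑ j ∈ S, ∑ l ∈ S, F l j m := fun F => Finset.sum_comm
  have h0 : ∑ m ∈ S, ∑ j ∈ S, ∑ l ∈ S, (D l j m + D j l m + D j m l + D m j l + D m l j +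
      D l m j) = 0 := by simp only [h, Finset.sum_const_zero]
  simp only [Finset.sum_add_distrib] at h0
  have h1 := hA D
  have h2 := hB D
  have h3 := hB fun l j m => D j l m
  have h4 := hA fun l j m => D l m j
  have h5 := hA fun l j m => D m l j
  rw [h5, h4, h3, h2, h1] at h0
  linear_combination h0 / 6

/-- Every coefficient is a multiple of the wave vector rotated by a right angle. -/
theorem exists_stream (u : H) : ∃ φ : Wave → ℂ, ∀ k : Wave,
    coeff u k 0 = φ k * (-(k.2 : ℂ)) ∧ coeff u k 1 = φ k * (k.1 : ℂ) := by
  have h : ∀ k : Wave, ∃ c : ℂ, coeff u k 0 = c * (-(k.2 : ℂ)) ∧ coeff u k 1 = c * (k.1 : ℂ) := by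
    intro k
    have hd : (k.1 : ℂ) * coeff u k 0 + (k.2 : ℂ) * coeff u k 1 = 0 := u.2.2.1 k
    by_cases h1 : k.1 = 0
    · by_cases h2 : k.2 = 0
      · have hk : k = 0 := Prod.ext h1 h2
        have h0 : coeff u k = 0 := by rw [hk]; exact u.2.1
        exact ⟨0, by simp [h0]⟩
      · have h2' : (k.2 : ℂ) ≠ 0 := by exact_mod_cast h2
        refine ⟨-coeff u k 0 / k.2, by field_simp, ?_⟩
        simp only [h1, Int.cast_zero, zero_mul, zero_add, mul_eq_zero, h2', false_or] at hd
        simp [hd, h1]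
    · have h1' : (k.1 : ℂ) ≠ 0 := by exact_mod_cast h1
      refine ⟨coeff u k 1 / k.1, ?_, by field_simp⟩
      field_simp
      linear_combination hd
  choose φ hφ using h
  exact ⟨φ, hφ⟩

/-- The square of wave vectors with coordinates bounded by `N`. -/
def box (N : ℕ) : Finset Wave := Finset.Icc (-(N : ℤ)) N ×ˢ Finset.Icc (-(N : ℤ)) N

theorem neg_mem_box {N : ℕ} {k : Wave} : -k ∈ box N ↔ k ∈ box N := by
  simp only [box, Finset.mem_product, Finset.mem_Icc, Prod.fst_neg, Prod.snd_neg]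
  omega

theorem mem_box_of_waveSq_le {N : ℕ} {k : Wave} (h : waveSq k ≤ N) : k ∈ box N := by
  have h' : k.1 ^ 2 + k.2 ^ 2 ≤ (N : ℤ) := by unfold waveSq at h; exact_mod_cast h
  simp only [box, Finset.mem_product, Finset.mem_Icc]
  refine ⟨⟨?_, ?_⟩, ?_, ?_⟩ <;> nlinarith [sq_nonneg k.1, sq_nonneg k.2, sq_nonneg (k.1 - 1),
    sq_nonneg (k.2 - 1), sq_nonneg (k.1 + 1), sq_nonneg (k.2 + 1)]

/-- The real inner product of two vectors of `ℂ²`. -/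
def pair (a b : CVec) : ℝ := ∑ i : Fin 2, (a i * star (b i)).re

theorem pair_self (a : CVec) : pair a a = ∑ i : Fin 2, ‖a i‖ ^ 2 := by
  simp only [pair, Complex.star_def, Complex.mul_conj, Complex.ofReal_re, Complex.normSq_eq_norm_sq]

theorem pair_self_nonneg (a : CVec) : 0 ≤ pair a a := by
  rw [pair_self]; positivity

theorem eq_zero_of_pair_self {a : CVec} (h : pair a a = 0) : a = 0 := by
  rw [pair_self, Finset.sum_eq_zero_iff_of_nonneg (fun i _ => by positivity)] at h
  ext i
  simpa using h i (Finset.mem_univ i)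

@[simp] theorem pair_zero_left (a : CVec) : pair 0 a = 0 := by simp [pair]

@[simp] theorem pair_zero_right (a : CVec) : pair a 0 = 0 := by simp [pair]

/-- The gradient part of `B` is parallel to `k`, hence orthogonal to `û(k)` by incompressibility;
reality turns the conjugate of `û(k)` into `û(-k)`. -/
theorem pair_bilin_eq (u : H) {N : ℕ} (hu : ∀ k, coeff u k ≠ 0 → k ∈ box N) (k : Wave) :
    pair (bilin (coeff u) (coeff u) k) (coeff u k) =
      (Complex.I * ∑ j ∈ box N, cdot (coeff u (k - j)) (waveVec j) *
        cdot (coeff u j) (coeff u (-k))).re := by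
  have h0 : coeff u 0 = 0 := u.2.1
  by_cases hk : k = 0
  · subst hk; simp [h0, cdot]
  have hb : bilin (coeff u) (coeff u) k = Complex.I • ∑ j ∈ box N,
      (cdot (coeff u (k - j)) (waveVec j) • coeff u j -
        (cdot (coeff u (k - j)) (waveVec j) * cdot (coeff u j) (waveVec k) / (waveSq k : ℂ)) •
          waveVec k) := by
    rw [bilin, if_neg hk, tsum_eq_sum]
    intro j hj
    have : coeff u j = 0 := by_contra fun h => hj (hu j h)
    simp [this, cdot]
  have hd : (k.1 : ℂ) * coeff u (-k) 0 + (k.2 : ℂ) * coeff u (-k) 1 = 0 := by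
    have h := u.2.2.1 (-k)
    change ((-k).1 : ℂ) * coeff u (-k) 0 + ((-k).2 : ℂ) * coeff u (-k) 1 = 0 at h
    push_cast [Prod.fst_neg, Prod.snd_neg] at h
    linear_combination -h
  have hs : ∀ i, star (coeff u k i) = coeff u (-k) i := u.2.2.2 k
  rw [pair, ← Complex.re_sum]
  congr 1
  rw [hb, Fin.sum_univ_two, hs, hs]
  simp only [PiLp.smul_apply, WithLp.ofLp_sum, Finset.sum_apply, PiLp.sub_apply, smul_eq_mul,
    Finset.mul_sum, Finset.sum_mul]
  rw [← Finset.sum_add_distrib]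
  refine Finset.sum_congr rfl fun j _ => ?_
  have w0 : waveVec k 0 = (k.1 : ℂ) := rfl
  have w1 : waveVec k 1 = (k.2 : ℂ) := rfl
  rw [w0, w1]
  generalize cdot (coeff u (k - j)) (waveVec j) * cdot (coeff u j) (waveVec k) /
    (waveSq k : ℂ) = c
  simp only [cdot]
  linear_combination (-Complex.I * c) * hd

/-- The transfer by `B` into a spectral multiplier vanishes when all the triads are balanced. -/
theorem sum_transfer_eq_zero (u : H) {N : ℕ} (hu : ∀ k, coeff u k ≠ 0 → k ∈ box N)
    (q : Wave → ℝ) (hq : ∀ k, q (-k) = q k)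
    (hbal : ∀ l j m : Wave, l + j + m = 0 → coeff u l ≠ 0 → coeff u j ≠ 0 → coeff u m ≠ 0 →
      (waveSq l - waveSq j) * q m + (waveSq j - waveSq m) * q l +
        (waveSq m - waveSq l) * q j = 0) :
    ∑ k ∈ box N, q k * pair (bilin (coeff u) (coeff u) k) (coeff u k) = 0 := by
  obtain ⟨φ, hφ⟩ := exists_stream u
  let D : Wave → Wave → Wave → ℂ := fun l j m => if l + j + m = 0 then
    (q m : ℂ) * (cdot (coeff u l) (waveVec j) * cdot (coeff u j) (coeff u m)) else 0
  have hD : ∑ m ∈ box N, ∑ j ∈ box N, ∑ l ∈ box N, D l j m = 0 := by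
    refine sum_triple_eq_zero _ _ fun l j m => ?_
    by_cases hs : l + j + m = 0
    · have h2 : j + l + m = 0 := by rw [← hs]; abel
      have h3 : j + m + l = 0 := by rw [← hs]; abel
      have h4 : m + j + l = 0 := by rw [← hs]; abel
      have h5 : m + l + j = 0 := by rw [← hs]; abel
      have h6 : l + m + j = 0 := by rw [← hs]; abel
      simp only [D, hs, h2, h3, h4, h5, h6, if_true]
      by_cases hl : coeff u l = 0
      · simp [hl, cdot]
      by_cases hj : coeff u j = 0
      · simp [hj, cdot]
      by_cases hm : coeff u m = 0
      · simp [hm, cdot]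
      have hb := hbal l j m hs hl hj hm
      have hbC : ((waveSq l : ℂ) - waveSq j) * q m + ((waveSq j : ℂ) - waveSq m) * q l +
        ((waveSq m : ℂ) - waveSq l) * q j = 0 := by exact_mod_cast hb
      have m1 : (m.1 : ℂ) = -l.1 - j.1 := by
        have := congrArg Prod.fst hs
        simp only [Prod.fst_add, Prod.fst_zero] at this
        have h' : m.1 = -l.1 - j.1 := by omega
        rw [h']; push_cast; ring
      have m2 : (m.2 : ℂ) = -l.2 - j.2 := by
        have := congrArg Prod.snd hs
        simp only [Prod.snd_add, Prod.snd_zero] at this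
        have h' : m.2 = -l.2 - j.2 := by omega
        rw [h']; push_cast; ring
      have wl0 : ∀ k, waveVec k 0 = (k.1 : ℂ) := fun k => rfl
      have wl1 : ∀ k, waveVec k 1 = (k.2 : ℂ) := fun k => rfl
      simp only [waveSq] at hbC
      push_cast at hbC
      simp only [cdot, wl0, wl1, (hφ l).1, (hφ l).2, (hφ j).1, (hφ j).2, (hφ m).1, (hφ m).2]
      rw [m1, m2] at hbC ⊢
      -- Here `û(l) · j = φ l (l × j)` and `û(j) · û(m) = φ j φ m (j · m)`, while `l × j` is
      -- invariant under cyclic permutation of the triad. The factor of `q m` is thus `(l × j) (j -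
      -- l) · m = (l × j) (|l|² - |j|²)`.
      linear_combination (φ l * φ j * φ m * (l.1 * j.2 - l.2 * j.1)) * hbC
    · have h2 : ¬ j + l + m = 0 := fun h => hs (by rw [← h]; abel)
      have h3 : ¬ j + m + l = 0 := fun h => hs (by rw [← h]; abel)
      have h4 : ¬ m + j + l = 0 := fun h => hs (by rw [← h]; abel)
      have h5 : ¬ m + l + j = 0 := fun h => hs (by rw [← h]; abel)
      have h6 : ¬ l + m + j = 0 := fun h => hs (by rw [← h]; abel)
      simp [D, hs, h2, h3, h4, h5, h6]
  have hinner : ∀ m j, ∑ l ∈ box N, D l j m =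
      (q m : ℂ) * (cdot (coeff u (-m - j)) (waveVec j) * cdot (coeff u j) (coeff u m)) := by
    intro m j
    rw [Finset.sum_eq_single (-m - j)]
    · simp [D]
    · intro l _ hl
      have : ¬ l + j + m = 0 := fun h => hl (by
        rw [eq_sub_iff_add_eq, eq_neg_iff_add_eq_zero]; exact h)
      simp [D, this]
    · intro hl
      have : coeff u (-m - j) = 0 := by_contra fun h => hl (hu _ h)
      simp [D, this, cdot]
  have hre : ∑ k ∈ box N, q k * pair (bilin (coeff u) (coeff u) k) (coeff u k) =
      (Complex.I * ∑ m ∈ box N, ∑ j ∈ box N, ∑ l ∈ box N, D l j m).re := by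
    rw [Finset.mul_sum, Complex.re_sum]
    -- Pairing with mode `k` produced `û(-k)`, so the third member of the triad is `m = -k`.
    refine Finset.sum_nbij' (fun k => -k) (fun k => -k) (fun k hk => neg_mem_box.2 hk)
      (fun k hk => neg_mem_box.2 hk) (fun k _ => neg_neg k) (fun k _ => neg_neg k) fun k _ => ?_
    simp only [hinner, hq, neg_neg]
    rw [pair_bilin_eq u hu, ← Complex.re_ofReal_mul, ← Finset.mul_sum]
    congr 1
    ring
  rw [hre, hD]
  simp

/-! ### Coefficients and eigenmodes -/

theorem waveSq_nonneg (k : Wave) : 0 ≤ waveSq k := by unfold waveSq; positivity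

theorem coeff_zero (u : H) : coeff u 0 = 0 := u.2.1

theorem ext_coeff {u v : H} (h : ∀ k, coeff u k = coeff v k) : u = v :=
  Subtype.ext (lp.ext (funext h))

theorem coeff_add (u v : H) (k : Wave) : coeff (u + v) k = coeff u k + coeff v k := rfl

theorem coeff_smul (c : ℝ) (u : H) (k : Wave) : coeff (c • u) k = c • coeff u k := rfl

theorem one_le_waveSq {u : H} {k : Wave} (h : coeff u k ≠ 0) : 1 ≤ waveSq k := by
  have hk : k ≠ 0 := fun hk => h (hk ▸ coeff_zero u)
  have h1 : (1 : ℤ) ≤ k.1 ^ 2 + k.2 ^ 2 := by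
    by_contra! hlt
    have h0 : k.1 ^ 2 + k.2 ^ 2 = 0 := by nlinarith [sq_nonneg k.1, sq_nonneg k.2]
    have ha : k.1 = 0 := by nlinarith [sq_nonneg k.1, sq_nonneg k.2]
    have hb : k.2 = 0 := by nlinarith [sq_nonneg k.1, sq_nonneg k.2]
    exact hk (Prod.ext ha hb)
  unfold waveSq
  exact_mod_cast h1

theorem waveSq_eq_one_of_lt_two {u : H} {k : Wave} (h : coeff u k ≠ 0) (h2 : waveSq k < 2) :
    waveSq k = 1 := by
  have h1 := one_le_waveSq h
  unfold waveSq at *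
  have h1' : (1 : ℤ) ≤ k.1 ^ 2 + k.2 ^ 2 := by exact_mod_cast h1
  have h2' : k.1 ^ 2 + k.2 ^ 2 < (2 : ℤ) := by exact_mod_cast h2
  have : k.1 ^ 2 + k.2 ^ 2 = (1 : ℤ) := by omega
  exact_mod_cast this

theorem stokes_apply (a : Coeff) (k : Wave) : stokes a k = waveSq k • a k := by
  simp [stokes, stokesPow]

theorem waveSq_eq_of_eigen {g : H} {μ : ℝ} (hg : stokes (coeff g) = μ • coeff g) {k : Wave}
    (hk : coeff g k ≠ 0) : waveSq k = μ := by
  have h := congrFun hg k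
  rw [stokes_apply, Pi.smul_apply] at h
  exact smul_left_injective ℝ hk h

theorem coeff_eigProj_of_eq {μ : ℝ} (u : H) {k : Wave} (h : waveSq k = μ) :
    coeff (eigProj μ u) k = coeff u k := if_pos h

theorem coeff_eigProj_of_ne {μ : ℝ} (u : H) {k : Wave} (h : waveSq k ≠ μ) :
    coeff (eigProj μ u) k = 0 := if_neg h

/-! ### Evolution of weighted spectral sums -/

theorem hasDerivAt_coeff {u : ℝ → H} {u' : H} {t : ℝ} (h : HasDerivAt u u' t) (k : Wave)
    (i : Fin 2) : HasDerivAt (fun s => coeff (u s) k i) (coeff u' k i) t := by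
  let L : H →L[ℝ] ℂ := ((EuclideanSpace.proj i : CVec →L[ℂ] ℂ).restrictScalars ℝ).comp
    ((lp.evalCLM ℝ (fun _ : Wave => CVec) 2 k).comp H.subtypeL)
  exact L.hasFDerivAt.comp_hasDerivAt t h

theorem hasDerivAt_pair {u : ℝ → H} {u' : H} {t : ℝ} (h : HasDerivAt u u' t) (k : Wave) :
    HasDerivAt (fun s => pair (coeff (u s) k) (coeff (u s) k))
      (2 * pair (coeff u' k) (coeff (u t) k)) t := by
  have h2 : ∀ i : Fin 2, HasDerivAt
      (fun s => (coeff (u s) k i * star (coeff (u s) k i)).re)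
      (2 * (coeff u' k i * star (coeff (u t) k i)).re) t := by
    intro i
    have hc := hasDerivAt_coeff h k i
    have := Complex.reCLM.hasFDerivAt.comp_hasDerivAt t (hc.mul hc.star)
    refine this.congr_deriv ?_
    simp
    ring
  have := HasDerivAt.fun_sum fun i (_ : i ∈ Finset.univ) => h2 i
  rw [← Finset.mul_sum] at this
  exact this

theorem pair_sub_sub (a b c d : CVec) (w : ℝ) :
    pair (a - w • b - c) d = pair a d - w * pair b d - pair c d := by
  simp [pair, Fin.sum_univ_two]
  ring

theorem pair_smul_smul (w : ℝ) (a : CVec) : pair (w • a) (w • a) = w ^ 2 * pair a a := by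
  simp [pair, Fin.sum_univ_two]
  ring

theorem pair_smul_right (w : ℝ) (a b : CVec) : pair a (w • b) = w * pair a b := by
  simp [pair, Fin.sum_univ_two]
  ring

theorem scal_eq (a b : Coeff) : scal a b = (2 * Real.pi) ^ 2 * ∑' k, pair (a k) (b k) := rfl

theorem scal_eq_sum {a b : Coeff} {S : Finset Wave} (h : ∀ k, b k ≠ 0 → k ∈ S) :
    scal a b = (2 * Real.pi) ^ 2 * ∑ k ∈ S, pair (a k) (b k) := by
  rw [scal_eq, tsum_eq_sum]
  intro k hk
  rw [not_imp_comm.1 (h k) hk, pair_zero_right]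

theorem IsSolution.coeff_deriv {g : H} {u : ℝ → H} (h : IsSolution g u) (t : ℝ) :
    ∃ u' : H, HasDerivAt u u' t ∧ ∀ k, coeff u' k =
      coeff g k - waveSq k • coeff (u t) k - bilin (coeff (u t)) (coeff (u t)) k := by
  obtain ⟨u', hd, he⟩ := h.eqn t
  refine ⟨u', hd, fun k => ?_⟩
  have := congrFun he k
  rw [Pi.add_apply, Pi.add_apply, stokes_apply] at this
  rw [← this]
  abel

/-- The balance of a spectral multiplier along a band-limited solution. -/
theorem hasDerivAt_multiplier {g : H} {u : ℝ → H} (h : IsSolution g u) {N : ℕ}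
    (hu : ∀ t k, coeff (u t) k ≠ 0 → k ∈ box N)
    (q : Wave → ℝ) (hq : ∀ k, q (-k) = q k) (t : ℝ)
    (hbal : ∀ l j m : Wave, l + j + m = 0 → coeff (u t) l ≠ 0 → coeff (u t) j ≠ 0 →
      coeff (u t) m ≠ 0 → (waveSq l - waveSq j) * q m + (waveSq j - waveSq m) * q l +
        (waveSq m - waveSq l) * q j = 0) :
    HasDerivAt (fun s => ∑ k ∈ box N, q k * pair (coeff (u s) k) (coeff (u s) k))
      (2 * (∑ k ∈ box N, q k * pair (coeff g k) (coeff (u t) k) -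
        ∑ k ∈ box N, q k * waveSq k * pair (coeff (u t) k) (coeff (u t) k))) t := by
  obtain ⟨u', hd, he⟩ := h.coeff_deriv t
  have hsum := HasDerivAt.fun_sum fun k (_ : k ∈ box N) => (hasDerivAt_pair hd k).const_mul (q k)
  refine hsum.congr_deriv ?_
  have hB := sum_transfer_eq_zero (u t) (hu t) q hq hbal
  have : ∀ k, q k * (2 * pair (coeff u' k) (coeff (u t) k)) =
      2 * (q k * pair (coeff g k) (coeff (u t) k)) -
      2 * (q k * waveSq k * pair (coeff (u t) k) (coeff (u t) k)) -
      2 * (q k * pair (bilin (coeff (u t)) (coeff (u t)) k) (coeff (u t) k)) := by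
    intro k
    rw [he, pair_sub_sub]
    ring
  simp only [this, Finset.sum_sub_distrib, ← Finset.mul_sum, hB]
  ring

/-- The product `f(t) e^{ct}` is constant, and the bound on `f` makes its limit at `-∞` at most
zero. -/
theorem eq_zero_of_decay {f : ℝ → ℝ} {c C : ℝ} (hc : 0 < c) (h0 : ∀ t, 0 ≤ f t)
    (hC : ∀ t, f t ≤ C) (hf : ∀ t, HasDerivAt f (-(c * f t)) t) (t : ℝ) : f t = 0 := by
  have hd : ∀ s, HasDerivAt (fun s => f s * Real.exp (c * s)) 0 s := by
    intro s
    have he : HasDerivAt (fun s => Real.exp (c * s)) (Real.exp (c * s) * (c * 1)) s :=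
      ((hasDerivAt_id s).const_mul c).exp
    exact ((hf s).mul he).congr_deriv (by ring)
  have hconst : ∀ s, f s * Real.exp (c * s) = f t * Real.exp (c * t) := fun s =>
    is_const_of_deriv_eq_zero (fun s => (hd s).differentiableAt) (fun s => (hd s).deriv) s t
  have hlim : Filter.Tendsto (fun s => C * Real.exp (c * s)) Filter.atBot (nhds (C * 0)) :=
    (Real.tendsto_exp_atBot.comp (Filter.tendsto_id.const_mul_atBot hc)).const_mul C
  rw [mul_zero] at hlim
  have hle : f t * Real.exp (c * t) ≤ 0 := ge_of_tendsto' hlim fun s => by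
    rw [← hconst s]
    exact mul_le_mul_of_nonneg_right (hC s) (Real.exp_pos _).le
  have := Real.exp_pos (c * t)
  nlinarith [h0 t]

/-! ### Energy, enstrophy and projections as finite sums -/

theorem enstrophy_eq_sum {u : H} {N : ℕ} (hu : ∀ k, coeff u k ≠ 0 → k ∈ box N) :
    enstrophy u = (2 * Real.pi) ^ 2 *
      ∑ k ∈ box N, waveSq k * pair (coeff u k) (coeff u k) := by
  rw [enstrophy, normSq, scal_eq_sum (S := box N)]
  · congr 1
    refine Finset.sum_congr rfl fun k _ => ?_
    rw [stokesPow, pair_smul_smul, ← Real.sqrt_eq_rpow, Real.sq_sqrt (waveSq_nonneg k)]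
  · intro k hk
    refine hu k fun h => hk ?_
    rw [stokesPow, h, smul_zero]

theorem energy_eq_sum {u : H} {N : ℕ} (hu : ∀ k, coeff u k ≠ 0 → k ∈ box N) :
    energy u = (2 * Real.pi) ^ 2 * ∑ k ∈ box N, pair (coeff u k) (coeff u k) := by
  rw [energy, normSq, scal_eq_sum hu]

/-- The indicator of the circle `|k|² = μ`. -/
def circ (μ : ℝ) (k : Wave) : ℝ := if waveSq k = μ then 1 else 0

theorem normSq_eigProj {u : H} {N : ℕ} (hu : ∀ k, coeff u k ≠ 0 → k ∈ box N) (μ : ℝ) :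
    normSq (coeff (eigProj μ u)) = (2 * Real.pi) ^ 2 *
      ∑ k ∈ box N, circ μ k * pair (coeff u k) (coeff u k) := by
  rw [normSq, scal_eq_sum (S := box N)]
  · congr 1
    refine Finset.sum_congr rfl fun k _ => ?_
    by_cases h : waveSq k = μ
    · rw [coeff_eigProj_of_eq u h, circ, if_pos h, one_mul]
    · rw [coeff_eigProj_of_ne u h, circ, if_neg h, zero_mul, pair_zero_left]
  · intro k hk
    refine hu k fun h => hk ?_
    by_cases hw : waveSq k = μ
    · rw [coeff_eigProj_of_eq u hw, h]
    · rw [coeff_eigProj_of_ne u hw]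

theorem normSq_nonneg (a : Coeff) : 0 ≤ normSq a := by
  rw [normSq, scal_eq]
  exact mul_nonneg (by positivity) (tsum_nonneg fun k => pair_self_nonneg _)

theorem normSq_eigProj_le {u : H} {N : ℕ} (hu : ∀ k, coeff u k ≠ 0 → k ∈ box N) (μ : ℝ) :
    normSq (coeff (eigProj μ u)) ≤ normSq (coeff u) := by
  rw [normSq_eigProj hu, ← energy, energy_eq_sum hu]
  gcongr with k
  refine mul_le_of_le_one_left (pair_self_nonneg _) ?_
  unfold circ
  split_ifs <;> norm_num

theorem eigProj_eq_zero {u : H} {N : ℕ} (hu : ∀ k, coeff u k ≠ 0 → k ∈ box N) {μ : ℝ}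
    (h : normSq (coeff (eigProj μ u)) = 0) : eigProj μ u = 0 := by
  rw [normSq_eigProj hu, mul_eq_zero, Finset.sum_eq_zero_iff_of_nonneg] at h
  · have h' := h.resolve_left (by positivity)
    refine ext_coeff fun k => ?_
    change _ = (0 : CVec)
    by_cases hw : waveSq k = μ
    · rw [coeff_eigProj_of_eq u hw]
      by_contra hk
      have := h' k (hu k hk)
      rw [circ, if_pos hw, one_mul] at this
      exact hk (eq_zero_of_pair_self this)
    · rw [coeff_eigProj_of_ne u hw]
  · intro k _
    refine mul_nonneg ?_ (pair_self_nonneg _)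
    unfold circ
    split_ifs <;> norm_num

theorem normSq_eq_zero {u : H} {N : ℕ} (hu : ∀ k, coeff u k ≠ 0 → k ∈ box N)
    (h : normSq (coeff u) = 0) : u = 0 := by
  rw [← energy, energy_eq_sum hu, mul_eq_zero,
    Finset.sum_eq_zero_iff_of_nonneg fun k _ => pair_self_nonneg _] at h
  refine ext_coeff fun k => ?_
  change _ = (0 : CVec)
  by_contra hk
  exact hk (eq_zero_of_pair_self (h.resolve_left (by positivity) k (hu k hk)))

theorem IsBoundedSol.exists_le {u : ℝ → H} (h : IsBoundedSol u) :
    ∃ C, ∀ t, normSq (coeff (u t)) ≤ C := by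
  obtain ⟨C, hC⟩ := h
  refine ⟨C ^ 2, fun t => ?_⟩
  have h1 : Real.sqrt (normSq (coeff (u t))) ≤ C := hC ⟨t, rfl⟩
  exact (Real.sqrt_le_left ((Real.sqrt_nonneg _).trans h1)).1 h1

theorem exists_box (R : ℝ) : ∃ N : ℕ, ∀ k : Wave, waveSq k ≤ R → k ∈ box N :=
  ⟨⌈R⌉₊, fun _ hk => mem_box_of_waveSq_le (hk.trans (Nat.le_ceil R))⟩

theorem bilin_eq_zero {a b : Coeff} {k : Wave} (h : ∀ j, a (k - j) = 0 ∨ b j = 0) :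
    bilin a b k = 0 := by
  rw [bilin]
  split_ifs
  · rfl
  · rw [tsum_congr (g := fun _ => (0 : CVec)), tsum_zero, smul_zero]
    intro j
    rcases h j with h | h <;> simp [h, cdot]

/-! ### Arithmetic of short wave vectors -/

theorem coords_of_waveSq_two {k : Wave} (h : waveSq k = 2) :
    (k.1 = 1 ∨ k.1 = -1) ∧ (k.2 = 1 ∨ k.2 = -1) := by
  have h' : k.1 ^ 2 + k.2 ^ 2 = (2 : ℤ) := by unfold waveSq at h; exact_mod_cast h
  have h1 : k.1 ≤ 1 := by nlinarith [sq_nonneg k.2]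
  have h2 : -1 ≤ k.1 := by nlinarith [sq_nonneg k.2]
  have h3 : k.2 ≤ 1 := by nlinarith [sq_nonneg k.1]
  have h4 : -1 ≤ k.2 := by nlinarith [sq_nonneg k.1]
  generalize k.1 = x at *
  generalize k.2 = y at *
  interval_cases x <;> interval_cases y <;> simp_all

theorem coords_of_waveSq_one {k : Wave} (h : waveSq k = 1) :
    (k.1 = 0 ∧ (k.2 = 1 ∨ k.2 = -1)) ∨ (k.2 = 0 ∧ (k.1 = 1 ∨ k.1 = -1)) := by
  have h' : k.1 ^ 2 + k.2 ^ 2 = (1 : ℤ) := by unfold waveSq at h; exact_mod_cast h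
  have h1 : k.1 ≤ 1 := by nlinarith [sq_nonneg k.2]
  have h2 : -1 ≤ k.1 := by nlinarith [sq_nonneg k.2]
  have h3 : k.2 ≤ 1 := by nlinarith [sq_nonneg k.1]
  have h4 : -1 ≤ k.2 := by nlinarith [sq_nonneg k.1]
  generalize k.1 = x at *
  generalize k.2 = y at *
  interval_cases x <;> interval_cases y <;> simp_all

/-- The sum of a wave vector of length `1` and one of squared length `2`. -/
theorem waveSq_one_add_two {l j : Wave} (hl : waveSq l = 1) (hj : waveSq j = 2) :
    waveSq (l + j) = 1 ∨ waveSq (l + j) = 5 := by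
  simp only [waveSq, Prod.fst_add, Prod.snd_add]
  rcases coords_of_waveSq_two hj with ⟨h1 | h1, h2 | h2⟩ <;>
  rcases coords_of_waveSq_one hl with ⟨h3, h4 | h4⟩ | ⟨h3, h4 | h4⟩ <;>
  rw [h1, h2, h3, h4] <;> norm_num

/-- Both coordinates of the difference are even, so its squared length is a multiple of 4. Hence
modes on the circle of the force do not interact into that circle. -/
theorem waveSq_two_sub_two_ne {k j : Wave} (hk : waveSq k = 2) (hj : waveSq j = 2) :
    waveSq (k - j) ≠ 2 := by
  simp only [waveSq, Prod.fst_sub, Prod.snd_sub]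
  rcases coords_of_waveSq_two hk with ⟨h1 | h1, h2 | h2⟩ <;>
  rcases coords_of_waveSq_two hj with ⟨h3 | h3, h4 | h4⟩ <;>
  rw [h1, h2, h3, h4] <;> norm_num

theorem circ_neg (μ : ℝ) (k : Wave) : circ μ (-k) = circ μ k := by
  rw [circ, circ, waveSq_neg]

/-- The triads of three different lengths that are admitted by the eigenvalues `μ₋ < 2 < μ₊` do not
exist when `μ₊ ≠ 5`. -/
theorem no_triad {u : H} {μm μp : ℝ} (hm : μm < 2) (hp : 2 < μp) (h5 : μp ≠ 5)
    {l j m : Wave} (hs : l + j + m = 0) (hl : coeff u l ≠ 0)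
    (wl : waveSq l = μm) (wj : waveSq j = 2) (wm : waveSq m = μp) : False := by
  have h1 := waveSq_eq_one_of_lt_two hl (wl ▸ hm)
  have hm' : m = -(l + j) := (neg_eq_of_add_eq_zero_right hs).symm
  rw [hm', waveSq_neg] at wm
  rcases waveSq_one_add_two h1 wj with h | h
  · rw [h] at wm; linarith
  · exact h5 (wm ▸ h)

/-- The expression vanishes as soon as two lengths agree; otherwise the lengths are `μ₋`, `2`, `μ₊`
in some order, which `no_triad` excludes. -/
theorem balanced_of_support {u : H} {μm μp : ℝ} (hm : μm < 2) (hp : 2 < μp) (h5 : μp ≠ 5)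
    (hsupp : ∀ k, coeff u k ≠ 0 → waveSq k = μp ∨ waveSq k = μm ∨ waveSq k = 2)
    (q : Wave → ℝ) (hq : ∀ k k', waveSq k = waveSq k' → q k = q k') (l j m : Wave)
    (hs : l + j + m = 0) (hl : coeff u l ≠ 0) (hj : coeff u j ≠ 0) (hk : coeff u m ≠ 0) :
    (waveSq l - waveSq j) * q m + (waveSq j - waveSq m) * q l +
      (waveSq m - waveSq l) * q j = 0 := by
  by_cases e1 : waveSq l = waveSq j
  · rw [e1, hq l j e1]; ring
  by_cases e2 : waveSq j = waveSq m
  · rw [e2, hq j m e2]; ring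
  by_cases e3 : waveSq m = waveSq l
  · rw [e3, hq m l e3]; ring
  exfalso
  have s2 : j + l + m = 0 := by rw [← hs]; abel
  have s3 : j + m + l = 0 := by rw [← hs]; abel
  have s4 : m + j + l = 0 := by rw [← hs]; abel
  have s5 : m + l + j = 0 := by rw [← hs]; abel
  have s6 : l + m + j = 0 := by rw [← hs]; abel
  rcases hsupp l hl with a | a | a <;> rcases hsupp j hj with b | b | b <;>
    rcases hsupp m hk with c | c | c <;>
    first
    | exact e1 (a.trans b.symm)
    | exact e2 (b.trans c.symm)
    | exact e3 (c.trans a.symm)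
    | exact no_triad hm hp h5 hs hl a b c
    | exact no_triad hm hp h5 s2 hj b a c
    | exact no_triad hm hp h5 s3 hj b c a
    | exact no_triad hm hp h5 s4 hk c b a
    | exact no_triad hm hp h5 s5 hk c a b
    | exact no_triad hm hp h5 s6 hl a c b

theorem Decomp.support {g : H} {u : ℝ → H} {μp μm η : ℝ}
    (hg : stokes (coeff g) = (2 : ℝ) • coeff g) (hd : Decomp g u μp μm η) (t : ℝ) (k : Wave)
    (hk : coeff (u t) k ≠ 0) : waveSq k = μp ∨ waveSq k = μm ∨ waveSq k = 2 := by
  by_contra! h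
  refine hk ?_
  rw [hd t, coeff_add, coeff_add, coeff_smul, coeff_eigProj_of_ne _ h.1,
    coeff_eigProj_of_ne _ h.2.1, not_imp_comm.1 (waveSq_eq_of_eigen hg) h.2.2]
  simp

theorem Decomp.exists_box {g : H} {u : ℝ → H} {μp μm η : ℝ}
    (hg : stokes (coeff g) = (2 : ℝ) • coeff g) (hd : Decomp g u μp μm η) (hm : μm < 2)
    (hp : 2 < μp) : ∃ N : ℕ, ∀ t k, coeff (u t) k ≠ 0 → k ∈ box N := by
  obtain ⟨N, hN⟩ := NavierStokes2D.exists_box μp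
  refine ⟨N, fun t k hk => hN k ?_⟩
  rcases hd.support hg t k hk with h | h | h <;> linarith

/-! ### Rigidity when `μ₊ ≠ 5` -/

section NoForcing

variable {g : H} {u : ℝ → H} {μp μm η : ℝ}

theorem bilin_eigProj_eq_zero (hg : stokes (coeff g) = (2 : ℝ) • coeff g) (v : H) (hm : μm < 2)
    (hp : 2 < μp) (h5 : μp ≠ 5) {k : Wave} (hk : waveSq k = μp) :
    bilin (coeff (eigProj μm v)) (coeff g) k = 0 ∧
      bilin (coeff g) (coeff (eigProj μm v)) k = 0 := by
  have key : ∀ l j : Wave, l + j = k → coeff (eigProj μm v) l = 0 ∨ coeff g j = 0 := by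
    intro l j hlj
    by_contra! h
    have wl : waveSq l = μm := by_contra fun hw => h.1 (coeff_eigProj_of_ne v hw)
    refine no_triad hm hp h5 (m := -k) (by rw [hlj]; abel) h.1 wl
      (waveSq_eq_of_eigen hg h.2) (by rw [waveSq_neg, hk])
  exact ⟨bilin_eq_zero fun j => key _ _ (sub_add_cancel k j),
    bilin_eq_zero fun j => (key _ _ (add_sub_cancel j k)).symm⟩

theorem scal_eigProj_eq_zero {b : Coeff} {v : H} {μ : ℝ} (h : ∀ k, waveSq k = μ → b k = 0) :
    scal b (coeff (eigProj μ v)) = 0 := by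
  rw [scal_eq, tsum_congr (g := fun _ => (0 : ℝ)), tsum_zero, mul_zero]
  intro k
  by_cases hk : waveSq k = μ
  · rw [h k hk, pair_zero_left]
  · rw [coeff_eigProj_of_ne v hk, pair_zero_right]

/-- The indicator of the circle is a balanced multiplier and `g` has no mode there, so only
dissipation is left. A general `μ` serves both `μ₊` and `μ₋`. -/
theorem hasDerivAt_normSq_eigProj (hg : stokes (coeff g) = (2 : ℝ) • coeff g)
    (h : IsSolution g u) (hd : Decomp g u μp μm η) (hm : μm < 2) (hp : 2 < μp) (h5 : μp ≠ 5)
    {μ : ℝ} (hμ : μ ≠ 2) (t : ℝ) :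
    HasDerivAt (fun s => normSq (coeff (eigProj μ (u s))))
      (-(2 * μ * normSq (coeff (eigProj μ (u t))))) t := by
  obtain ⟨N, hN⟩ := hd.exists_box hg hm hp
  have hmul := (hasDerivAt_multiplier h hN (circ μ) (circ_neg μ) t
    (balanced_of_support hm hp h5 (hd.support hg t) _ fun k k' hk => by
      rw [circ, circ, hk])).const_mul ((2 * Real.pi) ^ 2)
  simp only [← normSq_eigProj (hN _)] at hmul
  refine hmul.congr_deriv ?_
  have hz : ∑ k ∈ box N, circ μ k * pair (coeff g k) (coeff (u t) k) = 0 := by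
    refine Finset.sum_eq_zero fun k _ => ?_
    by_cases hk : waveSq k = μ
    · rw [not_imp_comm.1 (waveSq_eq_of_eigen hg) (hk ▸ hμ), pair_zero_left, mul_zero]
    · rw [circ, if_neg hk, zero_mul]
  have hw : ∀ k, circ μ k * waveSq k = μ * circ μ k := by
    intro k
    by_cases hk : waveSq k = μ
    · rw [hk, mul_comm]
    · rw [circ, if_neg hk, zero_mul, mul_zero]
  simp only [hz, hw, normSq_eigProj (hN t), mul_assoc, ← Finset.mul_sum]
  ring

theorem eigProj_eq_zero_of_bounded (hg : stokes (coeff g) = (2 : ℝ) • coeff g)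
    (h : IsSolution g u) (hb : IsBoundedSol u) (hd : Decomp g u μp μm η) (hm : μm < 2)
    (hp : 2 < μp) (h5 : μp ≠ 5) {μ : ℝ} (hμ : μ ≠ 2) (t : ℝ) : eigProj μ (u t) = 0 := by
  obtain ⟨N, hN⟩ := hd.exists_box hg hm hp
  obtain ⟨C, hC⟩ := hb.exists_le
  rcases lt_or_ge 0 μ with h0 | h0
  · refine eigProj_eq_zero (hN t) ?_
    exact eq_zero_of_decay (c := 2 * μ) (by positivity) (fun s => normSq_nonneg _)
      (fun s => (normSq_eigProj_le (hN s) μ).trans (hC s))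
      (hasDerivAt_normSq_eigProj hg h hd hm hp h5 hμ) t
  · refine ext_coeff fun k => ?_
    by_contra hk
    have h1 := one_le_waveSq hk
    exact hk (coeff_eigProj_of_ne _ (by linarith))

end NoForcing

/-! ### Ghost solutions -/

section Ghost

variable {g : H} {u : ℝ → H}

/-- The multipliers `1` and `|k|²` balance every triad identically. Since `(A g, u) = 2 (g, u)`, the
enstrophy balance minus twice the energy balance leaves the sum below. -/
theorem IsGhost.balance (hg : stokes (coeff g) = (2 : ℝ) • coeff g) (h : IsGhost g u) {N : ℕ}
    (hN : ∀ t k, coeff (u t) k ≠ 0 → k ∈ box N) (t : ℝ) :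
    enstrophy (u t) = scal (coeff g) (coeff (u t)) ∧
      ∑ k ∈ box N, (waveSq k - 2) * (waveSq k * pair (coeff (u t) k) (coeff (u t) k)) = 0 := by
  have h1 := (hasDerivAt_multiplier h.sol hN (fun _ => 1) (fun _ => rfl) t
    fun l j m _ _ _ _ => by ring).const_mul ((2 * Real.pi) ^ 2)
  have h2 := (hasDerivAt_multiplier h.sol hN waveSq waveSq_neg t
    fun l j m _ _ _ _ => by ring).const_mul ((2 * Real.pi) ^ 2)
  simp only [one_mul, ← energy_eq_sum (hN _)] at h1
  simp only [← enstrophy_eq_sum (hN _)] at h2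
  have e1 := h1.unique (h.energy_const t)
  have e2 := h2.unique (h.enstrophy_const t)
  have hpi : (2 * Real.pi) ^ 2 ≠ 0 := by positivity
  simp only [mul_eq_zero, hpi, two_ne_zero, false_or, sub_eq_zero] at e1 e2
  have e3 : ∑ k ∈ box N, waveSq k * pair (coeff g k) (coeff (u t) k) =
      2 * ∑ k ∈ box N, pair (coeff g k) (coeff (u t) k) := by
    rw [Finset.mul_sum]
    refine Finset.sum_congr rfl fun k _ => ?_
    by_cases hk : coeff g k = 0
    · rw [hk, pair_zero_left, mul_zero, mul_zero]
    · rw [waveSq_eq_of_eigen hg hk]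
  constructor
  · rw [enstrophy_eq_sum (hN t), scal_eq_sum (hN t), e1]
  · simp only [sub_mul, Finset.sum_sub_distrib, ← Finset.mul_sum]
    simp only [mul_assoc] at e2
    rw [← e2, e3, e1, sub_self]

theorem IsGhost.energy_eq (h : IsGhost g u) (s t : ℝ) : energy (u s) = energy (u t) :=
  is_const_of_deriv_eq_zero (fun s => (h.energy_const s).differentiableAt)
    (fun s => (h.energy_const s).deriv) s t

theorem IsGhost.isBoundedSol (h : IsGhost g u) : IsBoundedSol u := by
  refine ⟨Real.sqrt (energy (u 0)), ?_⟩
  rintro _ ⟨t, rfl⟩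
  exact (congrArg Real.sqrt (h.energy_eq t 0)).le

/-- A ghost solution is not confined to the eigenspace of the force. -/
theorem IsGhost.not_mem_eigenspace (hg : stokes (coeff g) = (2 : ℝ) • coeff g)
    (h : IsGhost g u) (hs : ∀ t k, coeff (u t) k ≠ 0 → waveSq k = 2) : False := by
  obtain ⟨N, hN⟩ := exists_box 2
  have hu : ∀ t k, coeff (u t) k ≠ 0 → k ∈ box N := fun t k hk => hN k (hs t k hk).le
  obtain ⟨C, hC⟩ := h.isBoundedSol.exists_le
  -- `g / 2` is the steady state of `w' + A w = g`. On the circle `B(u, u)` vanishes, so the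
  -- deviation solves `v' = -2 v` and its squared norm decays at rate 4.
  let v : ℝ → H := fun t => u t - (1 / 2 : ℝ) • g
  have hsv : ∀ t k, coeff (v t) k ≠ 0 → waveSq k = 2 := by
    intro t k hk
    by_contra hw
    refine hk ?_
    change coeff (u t) k - (1 / 2 : ℝ) • coeff g k = 0
    rw [not_imp_comm.1 (hs t k) hw, not_imp_comm.1 (waveSq_eq_of_eigen hg) hw]
    simp
  have hv : ∀ t k, coeff (v t) k ≠ 0 → k ∈ box N := fun t k hk => hN k (hsv t k hk).le
  have hder : ∀ t, HasDerivAt (fun s => normSq (coeff (v s)))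
      (-(4 * normSq (coeff (v t)))) t := by
    intro t
    obtain ⟨u', hd, he⟩ := h.sol.coeff_deriv t
    have hdv : HasDerivAt v u' t := hd.sub_const _
    have hsum := (HasDerivAt.fun_sum fun k (_ : k ∈ box N) => hasDerivAt_pair hdv k).const_mul
      ((2 * Real.pi) ^ 2)
    simp only [← energy_eq_sum (hv _)] at hsum
    refine hsum.congr_deriv ?_
    suffices hk : ∀ k, 2 * pair (coeff u' k) (coeff (v t) k) =
        -4 * pair (coeff (v t) k) (coeff (v t) k) by
      rw [← energy, energy_eq_sum (hv t)]
      simp only [hk, ← Finset.mul_sum]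
      ring
    intro k
    by_cases hk : waveSq k = 2
    · have hB : bilin (coeff (u t)) (coeff (u t)) k = 0 := bilin_eq_zero fun j => by
        by_contra! hj
        exact waveSq_two_sub_two_ne hk (hs t _ hj.2) (hs t _ hj.1)
      have hu' : coeff u' k = (-2 : ℝ) • coeff (v t) k := by
        change _ = (-2 : ℝ) • (coeff (u t) k - (1 / 2 : ℝ) • coeff g k)
        rw [he, hB, hk]
        module
      rw [hu']
      simp [pair, Fin.sum_univ_two]
      ring
    · rw [not_imp_comm.1 (hsv t k) hk]
      simp
  have hbound : ∀ t, normSq (coeff (v t)) ≤ 2 * C + 2 * normSq (coeff ((1 / 2 : ℝ) • g)) := by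
    intro t
    have hg2 : ∀ k, coeff ((1 / 2 : ℝ) • g) k ≠ 0 → k ∈ box N := by
      intro k hk
      refine hN k (waveSq_eq_of_eigen hg fun h0 => hk ?_).le
      rw [coeff_smul, h0, smul_zero]
    refine le_trans ?_ (add_le_add_left (mul_le_mul_of_nonneg_left (hC t) zero_le_two) _)
    rw [← energy, ← energy, ← energy, energy_eq_sum (hv t), energy_eq_sum (hu t),
      energy_eq_sum hg2, mul_left_comm, mul_left_comm 2, ← mul_add]
    refine mul_le_mul_of_nonneg_left ?_ (by positivity)
    rw [Finset.mul_sum, Finset.mul_sum, ← Finset.sum_add_distrib]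
    refine Finset.sum_le_sum fun k _ => ?_
    change pair (coeff (u t) k - coeff ((1 / 2 : ℝ) • g) k)
      (coeff (u t) k - coeff ((1 / 2 : ℝ) • g) k) ≤ _
    simp only [pair_self, Fin.sum_univ_two, PiLp.sub_apply]
    have hsq : ∀ a b : ℂ, ‖a - b‖ ^ 2 ≤ 2 * ‖a‖ ^ 2 + 2 * ‖b‖ ^ 2 := fun a b => by
      have := norm_sub_le a b
      nlinarith [norm_nonneg (a - b), sq_nonneg (‖a‖ - ‖b‖)]
    linarith [hsq (coeff (u t) k 0) (coeff ((1 / 2 : ℝ) • g) k 0),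
      hsq (coeff (u t) k 1) (coeff ((1 / 2 : ℝ) • g) k 1)]
  have hzero : ∀ t, u t = (1 / 2 : ℝ) • g := fun t => sub_eq_zero.1
    (normSq_eq_zero (hv t) (eq_zero_of_decay four_pos (fun s => normSq_nonneg _) hbound hder t))
  exact h.nonstationary fun s t => by rw [hzero s, hzero t]

/-- A ghost solution has modes both inside and outside the circle of the force. -/
theorem IsGhost.not_one_sided (hg : stokes (coeff g) = (2 : ℝ) • coeff g) (h : IsGhost g u)
    {N : ℕ} (hN : ∀ t k, coeff (u t) k ≠ 0 → k ∈ box N)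
    (hs : (∀ t k, coeff (u t) k ≠ 0 → waveSq k ≤ 2) ∨
      ∀ t k, coeff (u t) k ≠ 0 → 2 ≤ waveSq k) : False := by
  refine h.not_mem_eigenspace hg fun t k hk => ?_
  have hb := (h.balance hg hN t).2
  -- Terms of one sign with zero sum vanish individually.
  have hterm : ∀ k ∈ box N,
      (waveSq k - 2) * (waveSq k * pair (coeff (u t) k) (coeff (u t) k)) = 0 := by
    rcases hs with hs | hs
    · refine (Finset.sum_eq_zero_iff_of_nonpos fun k _ => ?_).1 hb
      by_cases hk : coeff (u t) k = 0
      · simp [hk]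
      · exact mul_nonpos_of_nonpos_of_nonneg (by linarith [hs t k hk])
          (mul_nonneg (waveSq_nonneg k) (pair_self_nonneg _))
    · refine (Finset.sum_eq_zero_iff_of_nonneg fun k _ => ?_).1 hb
      by_cases hk : coeff (u t) k = 0
      · simp [hk]
      · exact mul_nonneg (by linarith [hs t k hk])
          (mul_nonneg (waveSq_nonneg k) (pair_self_nonneg _))
  have h1 := one_le_waveSq hk
  rcases mul_eq_zero.1 (hterm k (hN t k hk)) with h2 | h2
  · linarith
  · rcases mul_eq_zero.1 h2 with h2 | h2
    · linarith
    · exact absurd (eq_zero_of_pair_self h2) hk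

/-- If `μ₋ ≠ 1` there is no mode inside the circle of the force; if `μ₊ ≠ 5`, rigidity makes `u`
equal to `η g`, hence stationary. -/
theorem IsGhost.eigenvalues (hg : stokes (coeff g) = (2 : ℝ) • coeff g) (h : IsGhost g u)
    {μp μm η : ℝ} (hd : Decomp g u μp μm η) (hm : μm < 2) (hp : 2 < μp) :
    μm = 1 ∧ μp = 5 := by
  obtain ⟨N, hN⟩ := hd.exists_box hg hm hp
  constructor
  · by_contra h1
    refine h.not_one_sided hg hN (Or.inr fun t k hk => ?_)
    rcases hd.support hg t k hk with hw | hw | hw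
    · linarith
    · exact absurd (hw ▸ waveSq_eq_one_of_lt_two hk (hw ▸ hm)) h1
    · exact hw.ge
  · by_contra h5
    have hz := fun {μ : ℝ} => eigProj_eq_zero_of_bounded hg h.sol h.isBoundedSol hd hm hp h5
      (μ := μ)
    have hu : ∀ t, u t = η • g := fun t => by
      have := hd t
      rwa [hz hp.ne', hz hm.ne, zero_add, zero_add] at this
    exact h.nonstationary fun s t => by rw [hu s, hu t]

/-- The force sees only the modes with `|k|² = 2`, where `v` is `η g`. With `E = (g, u)` this
identifies `η`. -/
theorem scal_decomp {v : H} {μp μm η : ℝ} (hg : stokes (coeff g) = (2 : ℝ) • coeff g)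
    (hm : μm ≠ 2) (hp : μp ≠ 2) (hd : v = eigProj μp v + eigProj μm v + η • g) :
    scal (coeff g) (coeff v) = η * normSq (coeff g) := by
  suffices hk : ∀ k, pair (coeff g k) (coeff v k) = η * pair (coeff g k) (coeff g k) by
    rw [normSq, scal_eq, scal_eq, tsum_congr hk, tsum_mul_left]
    ring
  intro k
  by_cases hk : coeff g k = 0
  · rw [hk, pair_zero_left, pair_zero_left, mul_zero]
  · have hw := waveSq_eq_of_eigen hg hk
    have hv : coeff v k = η • coeff g k := by
      conv_lhs => rw [hd]
      rw [coeff_add, coeff_add, coeff_smul, coeff_eigProj_of_ne _ (hw ▸ hp.symm),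
        coeff_eigProj_of_ne _ (hw ▸ hm.symm), zero_add, zero_add]
    rw [hv, pair_smul_right]

/-! ### The chained relation mode by mode -/

theorem ChainRel.coeff_eq {γ β α : ℝ} (hc : ChainRel g u γ β α) (t : ℝ) (k : Wave) :
    (waveSq k ^ 2 - α * waveSq k - β) • coeff (u t) k = γ • coeff g k := by
  have h := congrFun (hc t).2 k
  rw [Pi.add_apply, Pi.add_apply, Pi.smul_apply, Pi.smul_apply, Pi.smul_apply, stokes_apply,
    stokesPow, Real.rpow_two] at h
  rw [sub_smul, sub_smul, h, mul_smul]
  abel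

theorem ChainRel.root_of_ne {γ β α : ℝ} (hg : stokes (coeff g) = (2 : ℝ) • coeff g)
    (hc : ChainRel g u γ β α) {t : ℝ} {k : Wave} (hk : coeff (u t) k ≠ 0) (hw : waveSq k ≠ 2) :
    waveSq k ^ 2 - α * waveSq k - β = 0 := by
  have h := hc.coeff_eq t k
  rw [not_imp_comm.1 (waveSq_eq_of_eigen hg) hw, smul_zero, smul_eq_zero] at h
  exact h.resolve_right hk

theorem ChainRel.exists_box {γ β α : ℝ} (hg : stokes (coeff g) = (2 : ℝ) • coeff g)
    (hc : ChainRel g u γ β α) : ∃ N : ℕ, ∀ t k, coeff (u t) k ≠ 0 → k ∈ box N := by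
  -- A root `x ≥ 1` of `x² = α x + β` is at most `|α| + |β|`, as division by `x` shows; the 2
  -- accounts for the circle of the force.
  obtain ⟨N, hN⟩ := NavierStokes2D.exists_box (2 + |α| + |β|)
  refine ⟨N, fun t k hk => hN k ?_⟩
  have h1 := one_le_waveSq hk
  by_cases hw : waveSq k = 2
  · rw [hw]; linarith [abs_nonneg α, abs_nonneg β]
  · have h := hc.root_of_ne hg hk hw
    have hα := le_abs_self α
    have hβ := le_abs_self β
    have hα0 := abs_nonneg α
    have hβ0 := abs_nonneg β
    by_contra! hlt
    nlinarith [mul_le_mul_of_nonneg_right hα (zero_le_one.trans h1),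
      mul_le_mul_of_nonneg_left h1 hβ0]

/-- The frequency of the force is not a root of the chained relation of a ghost solution. -/
theorem IsGhost.not_root {γ β α : ℝ} (hg : stokes (coeff g) = (2 : ℝ) • coeff g)
    (h : IsGhost g u) (hc : ChainRel g u γ β α) : 4 - 2 * α - β ≠ 0 := by
  intro h2
  obtain ⟨N, hN⟩ := hc.exists_box hg
  -- If 2 is a root, the other one is `α - 2`, so the modes off the circle all lie on one side of
  -- it.
  have hw : ∀ t k, coeff (u t) k ≠ 0 → waveSq k = 2 ∨ waveSq k = α - 2 := by
    intro t k hk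
    by_contra! hne
    have hr := hc.root_of_ne hg hk hne.1
    have : (waveSq k - 2) * (waveSq k - (α - 2)) = 0 := by linear_combination hr - h2
    rcases mul_eq_zero.1 this with h0 | h0
    · exact hne.1 (sub_eq_zero.1 h0)
    · exact hne.2 (sub_eq_zero.1 h0)
  refine h.not_one_sided hg hN ?_
  rcases le_total (α - 2) 2 with hα | hα
  · exact Or.inl fun t k hk => by rcases hw t k hk with h0 | h0 <;> linarith
  · exact Or.inr fun t k hk => by rcases hw t k hk with h0 | h0 <;> linarith

/-- The chained relation of a ghost solution has two real roots, on both sides of the frequency of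
the force, and it decomposes the solution. -/
theorem IsGhost.decomp {γ β α : ℝ} (hg : stokes (coeff g) = (2 : ℝ) • coeff g)
    (h : IsGhost g u) (hc : ChainRel g u γ β α) :
    0 < α ^ 2 + 4 * β ∧ muMinus α β < 2 ∧ 2 < muPlus α β ∧
      Decomp g u (muPlus α β) (muMinus α β) (γ / (4 - 2 * α - β)) := by
  have h2 := h.not_root hg hc
  obtain ⟨N, hN⟩ := hc.exists_box hg
  have hdisc : 0 < α ^ 2 + 4 * β := by
    by_contra! hle
    -- With a nonpositive discriminant the only possible real root is the double one, `α / 2`, again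
    -- on one side.
    have hw : ∀ t k, coeff (u t) k ≠ 0 → waveSq k = 2 ∨ waveSq k = α / 2 := by
      intro t k hk
      by_contra! hne
      have hr := hc.root_of_ne hg hk hne.1
      refine hne.2 (sub_eq_zero.1 (pow_eq_zero_iff two_ne_zero |>.1 ?_))
      nlinarith [sq_nonneg (waveSq k - α / 2)]
    refine h.not_one_sided hg hN ?_
    rcases le_total (α / 2) 2 with hα | hα
    · exact Or.inl fun t k hk => by rcases hw t k hk with h0 | h0 <;> linarith
    · exact Or.inr fun t k hk => by rcases hw t k hk with h0 | h0 <;> linarith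
  have hsq := Real.sq_sqrt hdisc.le
  have hpos := Real.sqrt_pos.2 hdisc
  have hfac : ∀ x : ℝ, x ^ 2 - α * x - β = (x - muPlus α β) * (x - muMinus α β) := by
    intro x
    unfold muPlus muMinus
    linear_combination hsq / 4
  have hlt : muMinus α β < muPlus α β := by unfold muPlus muMinus; linarith
  have hw : ∀ t k, coeff (u t) k ≠ 0 → waveSq k ≠ 2 →
      waveSq k = muPlus α β ∨ waveSq k = muMinus α β := by
    intro t k hk hne
    have hr := hc.root_of_ne hg hk hne
    rw [hfac] at hr
    exact (mul_eq_zero.1 hr).imp sub_eq_zero.1 sub_eq_zero.1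
  have hf2 := hfac 2
  have hm : muMinus α β < 2 := by
    by_contra! hle
    refine h.not_one_sided hg hN (Or.inr fun t k hk => ?_)
    by_cases h0 : waveSq k = 2
    · exact h0.ge
    · rcases hw t k hk h0 with h1 | h1 <;> linarith
  have hp : 2 < muPlus α β := by
    by_contra! hle
    refine h.not_one_sided hg hN (Or.inl fun t k hk => ?_)
    by_cases h0 : waveSq k = 2
    · exact h0.le
    · rcases hw t k hk h0 with h1 | h1 <;> linarith
  refine ⟨hdisc, hm, hp, fun t => ext_coeff fun k => ?_⟩
  rw [coeff_add, coeff_add, coeff_smul]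
  -- On the circle of the force the relation reads `(4 - 2 α - β) û(k) = γ ĝ(k)`, whence the value
  -- of `η`; off it, `û(k)` survives only at the two roots.
  by_cases h0 : waveSq k = 2
  · rw [coeff_eigProj_of_ne _ (h0 ▸ hp.ne), coeff_eigProj_of_ne _ (h0 ▸ hm.ne'), zero_add,
      zero_add, div_eq_inv_mul, mul_smul, ← hc.coeff_eq t k, h0,
      show (2 : ℝ) ^ 2 - α * 2 - β = 4 - 2 * α - β by ring, smul_smul, inv_mul_cancel₀ h2,
      one_smul]
  · rw [not_imp_comm.1 (waveSq_eq_of_eigen hg) h0, smul_zero, add_zero]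
    by_cases h1 : waveSq k = muPlus α β
    · rw [coeff_eigProj_of_eq _ h1, coeff_eigProj_of_ne _ (h1 ▸ hlt.ne'), add_zero]
    · rw [coeff_eigProj_of_ne _ h1, zero_add]
      by_cases h3 : waveSq k = muMinus α β
      · rw [coeff_eigProj_of_eq _ h3]
      · rw [coeff_eigProj_of_ne _ h3]
        by_contra hk
        exact (hw t k hk h0).elim h1 h3

end Ghost

end

end NavierStokes2D

theorem mainTheorem3 (g : H) (hg0 : g ≠ 0) (hg : stokes (coeff g) = (2 : ℝ) • coeff g) :
    -- the roots `μ₋`, `μ₊` of the chained relation, and the decomposition that they give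
    (∀ u : ℝ → H, IsGhost g u → ∀ γ β α : ℝ, ChainRel g u γ β α →
      0 < α ^ 2 + 4 * β ∧ muMinus α β = 1 ∧ muPlus α β = 5 ∧
      ∀ t, u t = eigProj 5 (u t) + eigProj 1 (u t) +
        (enstrophy (u t) / normSq (coeff g)) • g) ∧
    -- the eigenvalues in any decomposition of a chained ghost solution
    (∀ u : ℝ → H, IsChainedGhost g u → ∀ μm μp η : ℝ, μm < 2 → 2 < μp →
      Decomp g u μp μm η → μm = 1 ∧ μp = 5) ∧
    -- the case `μ₊ ≠ 5`
    (∀ u : ℝ → H, IsSolution g u → IsBoundedSol u → ∀ μm μp η : ℝ, μm < 2 → 2 < μp →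
      Decomp g u μp μm η → μp ≠ 5 →
      (∀ t, scal (bilin (coeff (eigProj μm (u t))) (coeff g)) (coeff (eigProj μp (u t))) = 0 ∧
        scal (bilin (coeff g) (coeff (eigProj μm (u t)))) (coeff (eigProj μp (u t))) = 0 ∧
        HasDerivAt (fun s => (1 / 2) * normSq (coeff (eigProj μp (u s))))
          (-(μp * normSq (coeff (eigProj μp (u t))))) t ∧
        eigProj μp (u t) = 0 ∧ u t = η • g) ∧
      IsSteady u) := by
  refine ⟨fun u h γ β α hc => ?_, fun u h μm μp η hm hp hd => h.1.eigenvalues hg hd hm hp,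
    fun u h hb μm μp η hm hp hd h5 => ?_⟩
  · obtain ⟨hdisc, hm, hp, hd⟩ := h.decomp hg hc
    obtain ⟨e1, e5⟩ := h.eigenvalues hg hd hm hp
    refine ⟨hdisc, e1, e5, fun t => ?_⟩
    obtain ⟨N, hN⟩ := hc.exists_box hg
    have hgn : normSq (coeff g) ≠ 0 := by
      obtain ⟨M, hM⟩ := exists_box 2
      exact fun h0 => hg0 (normSq_eq_zero (fun k hk => hM k (waveSq_eq_of_eigen hg hk).le) h0)
    -- `E = (g, u) = η |g|²`, so the quotient `E / |g|²` is `η`.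
    rw [(h.balance hg hN t).1, scal_decomp hg hm.ne hp.ne' (hd t), mul_div_cancel_right₀ _ hgn,
      ← e1, ← e5]
    exact hd t
  · have hz := fun {μ : ℝ} => eigProj_eq_zero_of_bounded hg h hb hd hm hp h5 (μ := μ)
    have hu : ∀ t, u t = η • g := fun t => by
      have := hd t
      rwa [hz hp.ne', hz hm.ne, zero_add, zero_add] at this
    refine ⟨fun t => ⟨?_, ?_, ?_, hz hp.ne' t, hu t⟩, fun s t => by rw [hu s, hu t]⟩
    · exact scal_eigProj_eq_zero fun k hk => (bilin_eigProj_eq_zero hg (u t) hm hp h5 hk).1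
    · exact scal_eigProj_eq_zero fun k hk => (bilin_eigProj_eq_zero hg (u t) hm hp h5 hk).2
    · exact ((hasDerivAt_normSq_eigProj hg h hd hm hp h5 hp.ne' t).const_mul (1 / 2)).congr_deriv
        (by ring)
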